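/- For every $t\ge 1$ let $\beta^{(t)}=(\beta_1,\dots,\beta_t)\in\mathbb R^t$ (the entries may depend on $t$), and let $\mathcal G_t$ be a random undirected graph on the vertices $1,\dots,t$ in which distinct vertices $i,j$ are joined by an edge with probability $e^{\beta_i+\beta_j}/(1+e^{\beta_i+\beta_j})$, independently of all other edges (the $\beta$-model). Let $d=(d_1,\dots,d_t)^T$ be the vector of the degrees of $\mathcal G_t$, and let $L_t=\max_{1\le i\le t}|\beta_i|$. For $i\ne j$ put $$v_{i,j}=\frac{e^{\beta_i+\beta_j}}{(1+e^{\beta_i+\beta_j})^2},\qquad v_{i,i}=\sum_{j\ne i}v_{i,j},\qquad v_{\cdot\cdot}=\sum_{i\ne j}v_{i,j},$$ and let $S_t=(s_{i,j})_{t\times t}$ with $s_{i,j}=\delta_{i,j}/v_{i,i}-1/v_{\cdot\cdot}$, where $\delta_{i,j}$ is the Kronecker delta. Suppose that $e^{L_t}=o(t^{1/2})$ as $t\to\infty$. Then for every fixed $r\ge 1$, as $t\to\infty$, the vector consisting of the first $r$ elements of $S_t\{d-E(d)\}$ is asymptotically multivariate normal with mean zero and covariance matrix $C_t=\mathrm{diag}(v_{1,1}^{-1},\dots,v_{r,r}^{-1})$;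 that is, $C_t^{-1/2}$ times this vector converges in distribution to the standard normal law $N(0,I_r)$ on $\mathbb R^r$. -/

import Mathlib

open MeasureTheory ProbabilityTheory Filter Asymptotics

noncomputable section

namespace BetaModel

/-- The probability `p_{i,j} = e^{β_i + β_j} / (1 + e^{β_i + β_j})` of an edge between `i` and `j`. -/
def edgeProb {t : ℕ} (β : Fin t → ℝ) (i j : Fin t) : ℝ :=
  Real.exp (β i + β j) / (1 + Real.exp (β i + β j))

/-- The random undirected graph `G` on the vertices `Fin t` follows, under the probability
measure `P`, the `β`-model: distinct vertices `i, j` are joined by an edge with probability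
`p_{i,j}`, independently of all other edges. -/
structure IsBetaModel {t : ℕ} {Ω : Type*} [MeasurableSpace Ω] (P : Measure Ω)
    (β : Fin t → ℝ) (G : Ω → SimpleGraph (Fin t)) : Prop where
  measurableSet_adj : ∀ i j : Fin t, MeasurableSet {ω | (G ω).Adj i j}
  measure_adj : ∀ i j : Fin t, i ≠ j →
    P {ω | (G ω).Adj i j} = ENNReal.ofReal (edgeProb β i j)
  indep_adj : iIndepSet
    (fun e : {e : Fin t × Fin t // e.1 < e.2} => {ω | (G ω).Adj e.1.1 e.1.2}) P

/-- `L_t = max_i |β_i|`. -/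
def L {t : ℕ} (β : Fin t → ℝ) : ℝ := ⨆ i, |β i|

/-- The matrix `V_t`: off the diagonal
`v_{i,j} = e^{β_i + β_j} / (1 + e^{β_i + β_j})^2`, and `v_{i,i} = ∑_{j ≠ i} v_{i,j}`. -/
def V {t : ℕ} (β : Fin t → ℝ) : Matrix (Fin t) (Fin t) ℝ :=
  Matrix.of fun i j =>
    if i = j then
      ∑ k ∈ Finset.univ.erase i, Real.exp (β i + β k) / (1 + Real.exp (β i + β k)) ^ 2
    else Real.exp (β i + β j) / (1 + Real.exp (β i + β j)) ^ 2

/-- `v_{··} = ∑_{i ≠ j} v_{i,j}`. -/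
def vTotal {t : ℕ} (β : Fin t → ℝ) : ℝ :=
  ∑ i : Fin t, ∑ j ∈ Finset.univ.erase i, V β i j

/-- The matrix `S_t`, with entries `s_{i,j} = δ_{i,j} / v_{i,i} - 1 / v_{··}`. -/
def S {t : ℕ} (β : Fin t → ℝ) : Matrix (Fin t) (Fin t) ℝ :=
  Matrix.of fun i j => (if i = j then 1 else 0) / V β i i - 1 / vTotal β

/-- The matrix `G_t⁻¹ = diag(1 / v_{1,1}, …, 1 / v_{t,t})`. -/
def Ginv {t : ℕ} (β : Fin t → ℝ) : Matrix (Fin t) (Fin t) ℝ :=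
  Matrix.diagonal fun i => (V β i i)⁻¹

open Classical in
/-- The degree vector `d = (d_1, …, d_t)` of a graph. -/
def degreeVec {t : ℕ} (H : SimpleGraph (Fin t)) : Fin t → ℝ :=
  fun i => (H.degree i : ℝ)

/-- The centred degree vector `d - E(d)` of a random graph. -/
def centredDegree {t : ℕ} {Ω : Type*} [MeasurableSpace Ω] (P : Measure Ω)
    (G : Ω → SimpleGraph (Fin t)) (ω : Ω) : Fin t → ℝ :=
  fun i => degreeVec (G ω) i - ∫ ω', degreeVec (G ω') i ∂P

/-- The first `r` elements of a vector of length `t ≥ r` (zero if `t < r`, which is immaterial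
as `t → ∞`). -/
def firstElems (r : ℕ) {t : ℕ} (x : Fin t → ℝ) : Fin r → ℝ :=
  if h : r ≤ t then fun i => x (Fin.castLE h i) else 0

/-- The upper left `r × r` block of a `t × t` matrix with `t ≥ r` (zero if `t < r`). -/
def leadingBlock (r : ℕ) {t : ℕ} (A : Matrix (Fin t) (Fin t) ℝ) : Matrix (Fin r) (Fin r) ℝ :=
  if h : r ≤ t then A.submatrix (Fin.castLE h) (Fin.castLE h) else 0

/-- The random vectors `X t` are asymptotically `r`-variate normal with means `m t` and covariance
matrices `C t`: for all large `t` the matrix `C t` is positive definite with positive definite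
square root `R t`, and `(R t)⁻¹ (X t - m t)` converges in distribution, as `t → ∞`, to the standard
normal distribution on `ℝ ^ r`. -/
def IsAsymptoticallyNormal {r : ℕ} {Ω : ℕ → Type*} [∀ t, MeasurableSpace (Ω t)]
    (P : ∀ t, Measure (Ω t)) [∀ t, IsProbabilityMeasure (P t)]
    (X : ∀ t, Ω t → Fin r → ℝ) (m : ℕ → Fin r → ℝ) (C : ℕ → Matrix (Fin r) (Fin r) ℝ) : Prop :=
  ∃ R : ℕ → Matrix (Fin r) (Fin r) ℝ,
    (∀ᶠ t in atTop, (R t).PosDef ∧ R t * R t = C t) ∧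
    TendstoInDistribution
      (fun t (ω : Ω t) => WithLp.toLp 2 ((R t)⁻¹.mulVec (X t ω - m t)))
      atTop (fun z : EuclideanSpace ℝ (Fin r) => z) P (stdGaussian (EuclideanSpace ℝ (Fin r)))

end BetaModel

end

/-! By Lévy's continuity theorem it suffices to treat a fixed linear combination of the standardized
coordinates. Each degree is a sum of edge indicators, so such a combination is a sum over unordered
pairs of independent centred Bernoulli variables, the pair `{i, j}` carrying the coefficient `b i +
b j` with `b = degreeWeight`. If all coefficients are at most `M ≤ 1` in absolute value,
`norm_charFun_sum_bernoulli_sub_le` puts its characteristic function within `2 * M * σ` of the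
Gaussian one, `σ` being the variance.

Everything is then measured by `q = e^L / √t`, which tends to zero by hypothesis. Since `v_{i,i}` is
at least of order `q⁻²` and `v_{··}` at least of order `t q⁻²`, the coefficients are `O(q)`
(`abs_degreeWeight_add_le`). The exact variance formula `sum_sq_degreeWeight_add_mul_V` shows that
`σ` differs from the squared length of the coefficient vector by `O(q²)` (`abs_variance_sub_le`). -/

namespace BetaModel

/-! ### Characteristic functions of weighted sums of independent centred indicators. -/

/-- The characteristic function of a centred Bernoulli variable is close to that of a Gaussian
variable of the same variance. -/
lemma norm_bernoulli_charFun_sub_le {p c : ℝ} (hp0 : 0 ≤ p) (hp1 : p ≤ 1) (hc : |c| ≤ 1) :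
    ‖(p : ℂ) * Complex.exp ((c * (1 - p) : ℝ) * Complex.I)
        + ((1 - p : ℝ) : ℂ) * Complex.exp ((-(c * p) : ℝ) * Complex.I)
        - Complex.exp ((-(c ^ 2 * (p * (1 - p)) / 2) : ℝ) : ℂ)‖
      ≤ 2 * |c| * (c ^ 2 * (p * (1 - p))) := by
  -- Second-order Taylor expansion; `2 / 9 = 4 / (3! * 3)` is the constant of `Complex.exp_bound` at
  -- `n = 3`.
  have key : ∀ y : ℝ, |y| ≤ 1 →
      ‖Complex.exp (y * Complex.I) - (1 + y * Complex.I - y ^ 2 / 2)‖ ≤ |y| ^ 3 * (2 / 9) := by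
    intro y hy
    have h := Complex.exp_bound (x := y * Complex.I) (by simpa using hy) (n := 3) (by norm_num)
    have e : ∑ m ∈ Finset.range 3, ((y : ℂ) * Complex.I) ^ m / (m.factorial : ℂ)
        = 1 + y * Complex.I - y ^ 2 / 2 := by
      simp [Finset.sum_range_succ, mul_pow, Nat.factorial]
      ring
    rw [e] at h
    refine h.trans (le_of_eq ?_)
    simp [Nat.factorial]
    norm_num
  have hq0 : 0 ≤ 1 - p := by linarith
  have hc0 := abs_nonneg c
  have hv0 : 0 ≤ p * (1 - p) := mul_nonneg hp0 hq0
  have hv1 : p * (1 - p) ≤ 1 / 4 := by nlinarith [sq_nonneg (p - 1 / 2)]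
  have hc2 : c ^ 2 = |c| ^ 2 := (sq_abs c).symm
  have a1 : |c * (1 - p)| = |c| * (1 - p) := by rw [abs_mul, abs_of_nonneg hq0]
  have a2 : |-(c * p)| = |c| * p := by rw [abs_neg, abs_mul, abs_of_nonneg hp0]
  have k1 := key (c * (1 - p)) (by rw [a1]; nlinarith)
  have k2 := key (-(c * p)) (by rw [a2]; nlinarith)
  rw [a1] at k1
  rw [a2] at k2
  set y := c ^ 2 * (p * (1 - p)) / 2 with hy
  have hc21 : |c| ^ 2 ≤ 1 := pow_le_one₀ hc0 hc
  have hy0 : 0 ≤ y := by positivity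
  have hyc : y ≤ |c| ^ 2 := by rw [hy, hc2]; nlinarith [sq_nonneg |c|]
  have hyv : y ≤ p * (1 - p) := by rw [hy, hc2]; nlinarith
  have k3 : ‖Complex.exp ((-y : ℝ) : ℂ) - (1 - y)‖ ≤ y ^ 2 := by
    have h := Real.abs_exp_sub_one_sub_id_le (x := -y)
      (by rw [abs_neg, abs_of_nonneg hy0]; linarith)
    have e : Complex.exp ((-y : ℝ) : ℂ) - (1 - y) = ((Real.exp (-y) - 1 - -y : ℝ) : ℂ) := by
      push_cast; ring
    rw [e, Complex.norm_real, Real.norm_eq_abs]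
    simpa using h
  -- The Taylor polynomials average to `1 - y`: the linear terms cancel because the variable is
  -- centred, and the quadratic ones add up to the variance.
  have split : (p : ℂ) * Complex.exp ((c * (1 - p) : ℝ) * Complex.I)
        + ((1 - p : ℝ) : ℂ) * Complex.exp ((-(c * p) : ℝ) * Complex.I)
        - Complex.exp ((-y : ℝ) : ℂ)
      = p * (Complex.exp ((c * (1 - p) : ℝ) * Complex.I)
            - (1 + (c * (1 - p) : ℝ) * Complex.I - (c * (1 - p) : ℝ) ^ 2 / 2))
        + ((1 - p : ℝ) : ℂ) * (Complex.exp ((-(c * p) : ℝ) * Complex.I)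
            - (1 + (-(c * p) : ℝ) * Complex.I - (-(c * p) : ℝ) ^ 2 / 2))
        - (Complex.exp ((-y : ℝ) : ℂ) - (1 - y)) := by
    rw [hy]
    push_cast
    ring
  have hneg : -(c ^ 2 * (p * (1 - p)) / 2) = -y := rfl
  rw [hneg, split]
  have n1 : ‖(p : ℂ)‖ = p := by rw [Complex.norm_real, Real.norm_of_nonneg hp0]
  have n2 : ‖((1 - p : ℝ) : ℂ)‖ = 1 - p := by rw [Complex.norm_real, Real.norm_of_nonneg hq0]
  have hy2 : y ^ 2 ≤ |c| * (c ^ 2 * (p * (1 - p))) := by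
    have : y ≤ |c| := by nlinarith
    nlinarith
  have hcub : p * ((|c| * (1 - p)) ^ 3 * (2 / 9)) + (1 - p) * ((|c| * p) ^ 3 * (2 / 9))
      ≤ |c| * (c ^ 2 * (p * (1 - p))) := by
    have e : p * ((|c| * (1 - p)) ^ 3 * (2 / 9)) + (1 - p) * ((|c| * p) ^ 3 * (2 / 9))
      = |c| * (|c| ^ 2 * (p * (1 - p))) * (((1 - p) ^ 2 + p ^ 2) * (2 / 9)) := by ring
    rw [e, hc2]
    exact mul_le_of_le_one_right (by positivity) (by nlinarith)
  calc _ ≤ _ := norm_sub_le _ _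
    _ ≤ (p * ((|c| * (1 - p)) ^ 3 * (2 / 9)) + (1 - p) * ((|c| * p) ^ 3 * (2 / 9))) + y ^ 2 := by
        refine add_le_add ((norm_add_le _ _).trans ?_) k3
        rw [norm_mul, norm_mul, n1, n2]
        gcongr
    _ ≤ _ := by linarith

/-- Telescoping: the factors are exchanged one at a time, and the remaining ones have norm at most
one. -/
lemma norm_prod_sub_prod_le {ι : Type*} (s : Finset ι) (f g : ι → ℂ)
    (hf : ∀ i ∈ s, ‖f i‖ ≤ 1) (hg : ∀ i ∈ s, ‖g i‖ ≤ 1) :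
    ‖∏ i ∈ s, f i - ∏ i ∈ s, g i‖ ≤ ∑ i ∈ s, ‖f i - g i‖ := by
  classical
  induction s using Finset.induction_on with
  | empty => simp
  | insert a s ha ih =>
    rw [Finset.prod_insert ha, Finset.prod_insert ha, Finset.sum_insert ha]
    have e : f a * ∏ i ∈ s, f i - g a * ∏ i ∈ s, g i
        = (f a - g a) * ∏ i ∈ s, f i + g a * (∏ i ∈ s, f i - ∏ i ∈ s, g i) := by ring
    have hP : ‖∏ i ∈ s, f i‖ ≤ 1 := by
      rw [norm_prod]
      exact Finset.prod_le_one (fun _ _ => norm_nonneg _)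
        fun i hi => hf i (Finset.mem_insert_of_mem hi)
    have hI := ih (fun i hi => hf i (Finset.mem_insert_of_mem hi))
      (fun i hi => hg i (Finset.mem_insert_of_mem hi))
    rw [e]
    refine (norm_add_le _ _).trans (add_le_add ?_ ?_)
    · rw [norm_mul]
      exact mul_le_of_le_one_right (norm_nonneg _) hP
    · rw [norm_mul]
      exact (mul_le_of_le_one_left (norm_nonneg _) (hg a (Finset.mem_insert_self _ _))).trans hI

lemma charFun_map_bernoulli {Ω : Type*} [MeasurableSpace Ω] {P : Measure Ω}
    [IsProbabilityMeasure P] {s : Set Ω} (hs : MeasurableSet s) (c : ℝ) {p : ℝ}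
    (hp : P.real s = p) :
    charFun (P.map fun ω => c * (s.indicator (fun _ => (1 : ℝ)) ω - p)) 1
      = (p : ℂ) * Complex.exp ((c * (1 - p) : ℝ) * Complex.I)
        + ((1 - p : ℝ) : ℂ) * Complex.exp ((-(c * p) : ℝ) * Complex.I) := by
  have hm : Measurable fun ω => c * (s.indicator (fun _ => (1 : ℝ)) ω - p) :=
    ((measurable_const.indicator hs).sub_const p).const_mul c
  rw [charFun_apply_real, integral_map hm.aemeasurable (by fun_prop)]
  have e : (fun ω => Complex.exp (((1 : ℝ) : ℂ) *
        ((c * (s.indicator (fun _ => (1 : ℝ)) ω - p) : ℝ) : ℂ) * Complex.I))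
      = fun ω => s.indicator (fun _ => Complex.exp ((c * (1 - p) : ℝ) * Complex.I)) ω
        + sᶜ.indicator (fun _ => Complex.exp ((-(c * p) : ℝ) * Complex.I)) ω := by
    funext ω
    by_cases h : ω ∈ s
    · simp [h]
    · simp [h]
  rw [e, integral_add ((integrable_const _).indicator hs) ((integrable_const _).indicator hs.compl),
    integral_indicator_const _ hs, integral_indicator_const _ hs.compl,
    probReal_compl_eq_one_sub hs, hp]
  simp

/-- A quantitative central limit theorem for weighted sums of independent indicators. -/
lemma norm_charFun_sum_bernoulli_sub_le {Ω ι : Type*} [Fintype ι] [MeasurableSpace Ω]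
    {P : Measure Ω} [IsProbabilityMeasure P] {s : ι → Set Ω} (hs : ∀ i, MeasurableSet (s i))
    (hind : iIndepSet s P) {p c : ι → ℝ} (hp : ∀ i, P.real (s i) = p i) {M : ℝ}
    (hM : ∀ i, |c i| ≤ M) (hM1 : M ≤ 1) :
    ‖charFun (P.map fun ω => ∑ i, c i * ((s i).indicator (fun _ => (1 : ℝ)) ω - p i)) 1
        - Complex.exp ((-((∑ i, c i ^ 2 * (p i * (1 - p i))) / 2) : ℝ) : ℂ)‖
      ≤ 2 * M * ∑ i, c i ^ 2 * (p i * (1 - p i)) := by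
  have hm : ∀ i, Measurable fun ω => c i * ((s i).indicator (fun _ => (1 : ℝ)) ω - p i) :=
    fun i => ((measurable_const.indicator (hs i)).sub_const _).const_mul _
  have hindf : iIndepFun (fun i ω => c i * ((s i).indicator (fun _ => (1 : ℝ)) ω - p i)) P :=
    (hind.iIndepFun_indicator (β := ℝ)).comp (fun i x => c i * (x - p i))
      (fun i => (measurable_id.sub_const _).const_mul _)
  have hp0 : ∀ i, 0 ≤ p i := fun i => hp i ▸ measureReal_nonneg
  have hp1 : ∀ i, p i ≤ 1 := fun i => hp i ▸ measureReal_le_one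
  have hv : ∀ i, 0 ≤ c i ^ 2 * (p i * (1 - p i)) := fun i =>
    mul_nonneg (sq_nonneg _) (mul_nonneg (hp0 i) (by linarith [hp1 i]))
  have e : Complex.exp ((-((∑ i, c i ^ 2 * (p i * (1 - p i))) / 2) : ℝ) : ℂ)
      = ∏ i, Complex.exp ((-(c i ^ 2 * (p i * (1 - p i)) / 2) : ℝ) : ℂ) := by
    rw [← Complex.exp_sum, ← Complex.ofReal_sum, Finset.sum_neg_distrib, Finset.sum_div]
  rw [hindf.charFun_map_fun_sum_eq_prod fun i => (hm i).aemeasurable, Finset.prod_apply, e]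
  refine (norm_prod_sub_prod_le _ _ _ ?_ ?_).trans ?_
  · intro i _
    have := Measure.isProbabilityMeasure_map (μ := P) (hm i).aemeasurable
    exact norm_charFun_le_one _
  · intro i _
    rw [Complex.norm_exp, Complex.ofReal_re]
    exact Real.exp_le_one_iff.2 (by linarith [hv i])
  · rw [Finset.mul_sum]
    refine Finset.sum_le_sum fun i _ => ?_
    rw [charFun_map_bernoulli (hs i) (c i) (hp i)]
    refine (norm_bernoulli_charFun_sub_le (hp0 i) (hp1 i) ((hM i).trans hM1)).trans ?_
    exact mul_le_mul_of_nonneg_right (by linarith [hM i]) (hv i)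

/-! ### Reduction to independent edges and the exact variance. -/

section Variance

variable {t : ℕ} {β : Fin t → ℝ}

lemma sum_sum_erase_eq_sum_lt (g : Fin t → Fin t → ℝ) :
    ∑ i, ∑ j ∈ Finset.univ.erase i, g i j
      = ∑ e : {e : Fin t × Fin t // e.1 < e.2}, (g e.1.1 e.1.2 + g e.1.2 e.1.1) := by
  have h1 : ∑ e : {e : Fin t × Fin t // e.1 < e.2}, (g e.1.1 e.1.2 + g e.1.2 e.1.1)
      = ∑ i, ∑ j, if i < j then g i j + g j i else 0 := by
    rw [← Fintype.sum_prod_type' (f := fun i j : Fin t => if i < j then g i j + g j i else 0),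
      ← Finset.sum_filter,
      Finset.sum_subtype (p := fun e : Fin t × Fin t => e.1 < e.2) _ (by simp)]
  have h2 : ∀ i j : Fin t, (if i < j then g i j + g j i else 0)
      = (if i < j then g i j else 0) + if i < j then g j i else 0 := by
    intro i j; split_ifs <;> simp
  have h3 : ∑ i : Fin t, ∑ j : Fin t, (if i < j then g j i else 0)
      = ∑ i : Fin t, ∑ j : Fin t, if j < i then g i j else 0 := Finset.sum_comm
  rw [h1]
  simp_rw [h2, Finset.sum_add_distrib]
  rw [h3, ← Finset.sum_add_distrib]
  refine Finset.sum_congr rfl fun i _ => ?_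
  rw [← Finset.sum_add_distrib, ← Finset.filter_ne', Finset.sum_filter]
  refine Finset.sum_congr rfl fun j _ => ?_
  rcases lt_trichotomy i j with h | h | h
  · simp [h, h.ne', h.not_gt]
  · simp [h]
  · simp [h, h.ne, h.not_gt]

lemma V_of_ne {i j : Fin t} (h : i ≠ j) :
    V β i j = Real.exp (β i + β j) / (1 + Real.exp (β i + β j)) ^ 2 := by
  simp [V, h]

lemma V_diag (i : Fin t) : V β i i = ∑ j ∈ Finset.univ.erase i, V β i j := by
  have : V β i i = ∑ k ∈ Finset.univ.erase i,
      Real.exp (β i + β k) / (1 + Real.exp (β i + β k)) ^ 2 := by simp [V]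
  rw [this]
  exact Finset.sum_congr rfl fun j hj => (V_of_ne (Finset.ne_of_mem_erase hj).symm).symm

lemma V_symm (i j : Fin t) : V β i j = V β j i := by
  rcases eq_or_ne i j with rfl | h
  · rfl
  · rw [V_of_ne h, V_of_ne h.symm, add_comm (β i)]

lemma vTotal_eq_sum_diag : vTotal β = ∑ i, V β i i :=
  Finset.sum_congr rfl fun i _ => (V_diag i).symm

lemma edgeProb_symm (i j : Fin t) : edgeProb β i j = edgeProb β j i := by
  rw [edgeProb, edgeProb, add_comm (β i)]

lemma edgeProb_nonneg (i j : Fin t) : 0 ≤ edgeProb β i j := by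
  unfold edgeProb; positivity

lemma edgeProb_mul_one_sub {i j : Fin t} (h : i ≠ j) :
    edgeProb β i j * (1 - edgeProb β i j) = V β i j := by
  have := Real.exp_pos (β i + β j)
  rw [V_of_ne h, edgeProb]
  field_simp
  ring

/-- The coefficients with which the centred degrees enter the linear combination of the entries of
`S (d - E d)` with coefficients `a`. -/
noncomputable def degreeWeight {t : ℕ} (β a : Fin t → ℝ) (k : Fin t) : ℝ :=
  a k / V β k k - (∑ i, a i) / vTotal β

lemma sum_mul_S_mulVec (a x : Fin t → ℝ) :
    ∑ i, a i * (S β).mulVec x i = ∑ k, degreeWeight β a k * x k := by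
  have h : ∀ i, (S β).mulVec x i = x i / V β i i - (∑ k, x k) / vTotal β := by
    intro i
    simp only [Matrix.mulVec, dotProduct, S, Matrix.of_apply, sub_mul, Finset.sum_sub_distrib]
    congr 1
    · simp [div_eq_inv_mul]
    · rw [Finset.sum_div]
      exact Finset.sum_congr rfl fun k _ => by ring
  simp_rw [h, degreeWeight, mul_sub, sub_mul, Finset.sum_sub_distrib, ← Finset.sum_mul,
    ← Finset.mul_sum]
  congr 1
  · exact Finset.sum_congr rfl fun k _ => by ring
  · ring

/-- The variance of the linear combination. The first term is the intended one; the other two come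
from the edges shared by two degrees and from the correction `1 / v_{··}` in `S`, and are shown
later to be negligible. -/
lemma sum_sq_degreeWeight_add_mul_V (a : Fin t → ℝ) (hV : ∀ i, V β i i ≠ 0)
    (hT : vTotal β ≠ 0) :
    ∑ e : {e : Fin t × Fin t // e.1 < e.2},
        (degreeWeight β a e.1.1 + degreeWeight β a e.1.2) ^ 2 * V β e.1.1 e.1.2
      = ∑ i, a i ^ 2 / V β i i
        + ∑ i, ∑ j ∈ Finset.univ.erase i, a i / V β i i * (a j / V β j j) * V β i j
        - 2 * (∑ i, a i) ^ 2 / vTotal β := by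
  set γ := (∑ i, a i) / vTotal β with hγ
  set w : Fin t → ℝ := fun i => a i / V β i i with hw
  have hb : ∀ k, degreeWeight β a k = w k - γ := fun k => rfl
  have hwV : ∀ i, w i * V β i i = a i := fun i => div_mul_cancel₀ _ (hV i)
  have hγT : γ * vTotal β = ∑ i, a i := div_mul_cancel₀ _ hT
  -- Expanding the square and passing to ordered pairs absorbs the factor 2 of the mixed term.
  have h1 : ∑ e : {e : Fin t × Fin t // e.1 < e.2},
        (degreeWeight β a e.1.1 + degreeWeight β a e.1.2) ^ 2 * V β e.1.1 e.1.2
      = ∑ i, ∑ j ∈ Finset.univ.erase i, ((w i - γ) ^ 2 * V β i j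
          + (w i - γ) * (w j - γ) * V β i j) := by
    rw [sum_sum_erase_eq_sum_lt]
    refine Finset.sum_congr rfl fun e _ => ?_
    rw [hb, hb, V_symm e.1.2 e.1.1]
    ring
  have h2 : ∀ i j, (w i - γ) ^ 2 * V β i j + (w i - γ) * (w j - γ) * V β i j
      = ((w i - γ) ^ 2 - γ * (w i - γ)) * V β i j - γ * (w j * V β j i)
          + w i * w j * V β i j := by
    intro i j
    rw [V_symm j i]
    ring
  have h3 : ∑ i, ∑ j ∈ Finset.univ.erase i, w j * V β j i = ∑ i, a i := by
    rw [sum_sum_erase_eq_sum_lt]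
    have := sum_sum_erase_eq_sum_lt (fun i j => w i * V β i j)
    simp_rw [← Finset.mul_sum, ← V_diag, hwV] at this
    rw [this]
    exact Finset.sum_congr rfl fun e _ => add_comm _ _
  -- By `hγT` the terms in `γ` add up to `-3 + 2 = -1` times `γ * ∑ a i`; `h6` supplies the second
  -- copy.
  have h4 : ∑ i, ((w i - γ) ^ 2 - γ * (w i - γ)) * V β i i
      = ∑ i, a i ^ 2 / V β i i - γ * ∑ i, a i := by
    have : ∀ i, ((w i - γ) ^ 2 - γ * (w i - γ)) * V β i i
        = a i ^ 2 / V β i i - 3 * γ * a i + 2 * γ ^ 2 * V β i i := by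
      intro i
      have := hV i
      simp only [hw]
      field_simp
      ring
    simp_rw [this, Finset.sum_add_distrib, Finset.sum_sub_distrib, ← Finset.mul_sum,
      ← vTotal_eq_sum_diag]
    rw [← hγT]
    ring
  rw [h1]
  simp_rw [h2, Finset.sum_add_distrib, Finset.sum_sub_distrib]
  have h5 : ∑ i, ∑ j ∈ Finset.univ.erase i, ((w i - γ) ^ 2 - γ * (w i - γ)) * V β i j
      = ∑ i, ((w i - γ) ^ 2 - γ * (w i - γ)) * V β i i :=
    Finset.sum_congr rfl fun i _ => by rw [← Finset.mul_sum, ← V_diag]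
  have h6 : ∑ i, ∑ j ∈ Finset.univ.erase i, γ * (w j * V β j i) = γ * ∑ i, a i := by
    simp_rw [← Finset.mul_sum]
    rw [h3]
  rw [h5, h4, h6]
  have : 2 * (∑ i, a i) ^ 2 / vTotal β = 2 * (γ * ∑ i, a i) := by rw [hγ]; ring
  rw [this]
  ring

variable {Ω : Type*} {G : Ω → SimpleGraph (Fin t)}

open Classical in
lemma degreeVec_eq_sum_indicator (ω : Ω) (i : Fin t) :
    degreeVec (G ω) i = ∑ j ∈ Finset.univ.erase i,
      {ω | (G ω).Adj i j}.indicator (fun _ => (1 : ℝ)) ω := by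
  rw [degreeVec, ← SimpleGraph.card_neighborFinset_eq_degree,
    SimpleGraph.neighborFinset_eq_filter, Finset.card_filter, ← Finset.filter_ne',
    Finset.sum_filter]
  push_cast
  refine Finset.sum_congr rfl fun j _ => ?_
  rcases eq_or_ne j i with rfl | h
  · simp
  · simp [h, Set.indicator_apply]

variable [MeasurableSpace Ω] {P : Measure Ω}

lemma IsBetaModel.measureReal_adj (hG : IsBetaModel P β G) {i j : Fin t} (h : i ≠ j) :
    P.real {ω | (G ω).Adj i j} = edgeProb β i j := by
  rw [Measure.real, hG.measure_adj i j h, ENNReal.toReal_ofReal (edgeProb_nonneg i j)]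

variable [IsProbabilityMeasure P]

lemma IsBetaModel.centredDegree_eq (hG : IsBetaModel P β G) (ω : Ω) (i : Fin t) :
    centredDegree P G ω i = ∑ j ∈ Finset.univ.erase i,
      ({ω | (G ω).Adj i j}.indicator (fun _ => (1 : ℝ)) ω - edgeProb β i j) := by
  have hI : ∫ ω', degreeVec (G ω') i ∂P = ∑ j ∈ Finset.univ.erase i, edgeProb β i j := by
    simp_rw [degreeVec_eq_sum_indicator]
    rw [integral_finsetSum _ fun j _ =>
      (integrable_const (1 : ℝ)).indicator (hG.measurableSet_adj i j)]
    refine Finset.sum_congr rfl fun j hj => ?_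
    rw [integral_indicator_const _ (hG.measurableSet_adj i j),
      hG.measureReal_adj (Finset.ne_of_mem_erase hj).symm]
    simp
  rw [centredDegree, hI, degreeVec_eq_sum_indicator, Finset.sum_sub_distrib]

lemma IsBetaModel.measurable_centredDegree (hG : IsBetaModel P β G) :
    Measurable fun ω => centredDegree P G ω := by
  refine measurable_pi_lambda _ fun i => ?_
  simp_rw [hG.centredDegree_eq]
  exact Finset.measurable_fun_sum _ fun j _ =>
    (measurable_const.indicator (hG.measurableSet_adj i j)).sub_const _

lemma IsBetaModel.sum_mul_S_mulVec_centredDegree (hG : IsBetaModel P β G) (a : Fin t → ℝ) (ω : Ω) :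
    ∑ i, a i * (S β).mulVec (centredDegree P G ω) i
      = ∑ e : {e : Fin t × Fin t // e.1 < e.2},
        (degreeWeight β a e.1.1 + degreeWeight β a e.1.2)
          * ({ω | (G ω).Adj e.1.1 e.1.2}.indicator (fun _ => (1 : ℝ)) ω
            - edgeProb β e.1.1 e.1.2) := by
  rw [sum_mul_S_mulVec]
  simp_rw [hG.centredDegree_eq, Finset.mul_sum]
  rw [sum_sum_erase_eq_sum_lt]
  refine Finset.sum_congr rfl fun e _ => ?_
  rw [edgeProb_symm e.1.2 e.1.1]
  simp_rw [SimpleGraph.adj_comm _ e.1.2 e.1.1]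
  ring

end Variance

/-! ### Estimates in terms of `e^L / √t`. -/

section Bounds

variable {t : ℕ} {β : Fin t → ℝ}

lemma abs_le_L (i : Fin t) : |β i| ≤ L β :=
  le_ciSup (f := fun i => |β i|) (Set.finite_range _).bddAbove i

lemma exp_neg_abs_div_four_le (x : ℝ) :
    Real.exp (-|x|) / 4 ≤ Real.exp x / (1 + Real.exp x) ^ 2 := by
  have hx := Real.exp_pos x
  rw [div_le_div_iff₀ (by norm_num) (by positivity)]
  rcases le_total 0 x with h | h
  · have h1 : 1 ≤ Real.exp x := Real.one_le_exp h
    have h2 : Real.exp (-|x|) * Real.exp x = 1 := by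
      rw [abs_of_nonneg h, ← Real.exp_add]; simp
    have h3 : (1 + Real.exp x) ^ 2 ≤ 4 * Real.exp x ^ 2 := by nlinarith
    calc Real.exp (-|x|) * (1 + Real.exp x) ^ 2
        ≤ Real.exp (-|x|) * (4 * Real.exp x ^ 2) := by gcongr
      _ = (Real.exp (-|x|) * Real.exp x) * (Real.exp x * 4) := by ring
      _ = Real.exp x * 4 := by rw [h2, one_mul]
  · have h1 : Real.exp x ≤ 1 := Real.exp_le_one_iff.2 h
    rw [abs_of_nonpos h, neg_neg]
    have h3 : (1 + Real.exp x) ^ 2 ≤ 4 := by nlinarith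
    gcongr

lemma le_V {i j : Fin t} (h : i ≠ j) : Real.exp (-(2 * L β)) / 4 ≤ V β i j := by
  rw [V_of_ne h]
  refine le_trans ?_ (exp_neg_abs_div_four_le _)
  have : |β i + β j| ≤ 2 * L β :=
    (abs_add_le _ _).trans (by linarith [abs_le_L (β := β) i, abs_le_L (β := β) j])
  gcongr

lemma V_nonneg {i j : Fin t} (h : i ≠ j) : 0 ≤ V β i j :=
  le_trans (by positivity) (le_V h)

lemma V_le {i j : Fin t} (h : i ≠ j) : V β i j ≤ 1 / 4 := by
  rw [V_of_ne h, div_le_div_iff₀ (by positivity) (by norm_num)]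
  nlinarith [sq_nonneg (1 - Real.exp (β i + β j))]

lemma exp_neg_two_mul_L :
    Real.exp (-(2 * L β)) * (Real.exp (L β) / √t) ^ 2 = 1 / t := by
  rw [div_pow, Real.sq_sqrt (Nat.cast_nonneg t), ← Real.exp_nat_mul, mul_div_assoc', ← Real.exp_add]
  simp

/-- Each of the `t - 1 ≥ t / 2` summands is at least `e^{-2L} / 4`, whence the constant 8. For `t =
1` the sum is empty, so `2 ≤ t` is needed. -/
lemma one_le_mul_V_diag (ht : 2 ≤ t) (i : Fin t) :
    1 ≤ 8 * (Real.exp (L β) / √t) ^ 2 * V β i i := by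
  have ht' : (2 : ℝ) ≤ t := by exact_mod_cast ht
  have h1 : ((t : ℝ) - 1) * (Real.exp (-(2 * L β)) / 4) ≤ V β i i := by
    rw [V_diag]
    refine le_trans (le_of_eq ?_)
      (Finset.card_nsmul_le_sum _ _ _ fun j hj => le_V (Finset.ne_of_mem_erase hj).symm)
    rw [Finset.card_erase_of_mem (Finset.mem_univ i), Finset.card_univ, Fintype.card_fin,
      nsmul_eq_mul, Nat.cast_sub (by omega), Nat.cast_one]
  calc (1 : ℝ) ≤ 2 * (t - 1) * (1 / t) := by
        rw [mul_one_div, le_div_iff₀ (by linarith)]; linarith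
    _ = 8 * (Real.exp (L β) / √t) ^ 2 * ((t - 1) * (Real.exp (-(2 * L β)) / 4)) := by
        rw [← exp_neg_two_mul_L (β := β)]; ring
    _ ≤ _ := by gcongr

lemma V_diag_pos (ht : 2 ≤ t) (i : Fin t) : 0 < V β i i := by
  by_contra! h
  have := one_le_mul_V_diag (β := β) ht i
  have h2 : 0 ≤ 8 * (Real.exp (L β) / √t) ^ 2 := by positivity
  nlinarith

lemma V_diag_le (i : Fin t) : V β i i ≤ t / 4 := by
  rw [V_diag]
  refine (Finset.sum_le_card_nsmul _ _ _ fun j hj =>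
    V_le (Finset.ne_of_mem_erase hj).symm).trans ?_
  rw [nsmul_eq_mul]
  have : ((Finset.univ.erase i).card : ℝ) ≤ t := by
    exact_mod_cast (Finset.card_le_univ _).trans_eq (Fintype.card_fin t)
  linarith

lemma le_mul_vTotal (ht : 2 ≤ t) : (t : ℝ) ≤ 8 * (Real.exp (L β) / √t) ^ 2 * vTotal β := by
  rw [vTotal_eq_sum_diag, Finset.mul_sum]
  refine le_trans (le_of_eq ?_)
    (Finset.card_nsmul_le_sum _ _ _ fun i _ => one_le_mul_V_diag (β := β) ht i)
  simp

lemma vTotal_pos (ht : 2 ≤ t) : 0 < vTotal β := by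
  rw [vTotal_eq_sum_diag]
  exact Finset.sum_pos (fun i _ => V_diag_pos ht i) ⟨⟨0, by omega⟩, Finset.mem_univ _⟩

lemma V_diag_le_mul_vTotal (ht : 2 ≤ t) (i : Fin t) :
    V β i i ≤ 2 * (Real.exp (L β) / √t) ^ 2 * vTotal β := by
  linarith [V_diag_le (β := β) i, le_mul_vTotal (β := β) ht]

lemma sqrt_V_diag_div_le (ht : 2 ≤ t) (i : Fin t) :
    √(V β i i) / V β i i ≤ 3 * (Real.exp (L β) / √t) := by
  have hV := V_diag_pos (β := β) ht i
  rw [Real.sqrt_div_self', div_le_iff₀ (Real.sqrt_pos.2 hV)]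
  rw [← one_le_sq_iff₀ (by positivity), mul_pow, Real.sq_sqrt hV.le]
  nlinarith [one_le_mul_V_diag (β := β) ht i]

lemma sqrt_V_diag_le (ht : 2 ≤ t) (i : Fin t) :
    √(V β i i) ≤ 2 * (Real.exp (L β) / √t) * √(vTotal β) := by
  have hT := vTotal_pos (β := β) ht
  refine Real.sqrt_le_iff.2 ⟨by positivity, ?_⟩
  rw [mul_pow, Real.sq_sqrt hT.le]
  have : 0 ≤ (Real.exp (L β) / √t) ^ 2 * vTotal β := by positivity
  nlinarith [V_diag_le_mul_vTotal (β := β) ht i]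

/-- The weights which turn the entries of `S (d - E d)` into a linear combination, with
coefficients `x`, of their standardized versions. -/
noncomputable def standardizedWeight {t : ℕ} (β x : Fin t → ℝ) (i : Fin t) : ℝ := x i * √(V β i i)

lemma sum_abs_standardizedWeight_div_le (ht : 2 ≤ t) (x : Fin t → ℝ) :
    ∑ i, |standardizedWeight β x i / V β i i|
      ≤ 3 * (∑ i, |x i|) * (Real.exp (L β) / √t) := by
  rw [Finset.mul_sum, Finset.sum_mul]
  refine Finset.sum_le_sum fun i _ => ?_
  have hV := V_diag_pos (β := β) ht i
  rw [standardizedWeight, mul_div_assoc, abs_mul,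
    abs_of_nonneg (a := √(V β i i) / V β i i) (by positivity)]
  nlinarith [sqrt_V_diag_div_le (β := β) ht i, abs_nonneg (x i)]

lemma abs_sum_standardizedWeight_le (ht : 2 ≤ t) (x : Fin t → ℝ) :
    |∑ i, standardizedWeight β x i|
      ≤ 2 * (∑ i, |x i|) * (Real.exp (L β) / √t) * √(vTotal β) := by
  refine (Finset.abs_sum_le_sum_abs _ _).trans ?_
  rw [Finset.mul_sum, Finset.sum_mul, Finset.sum_mul]
  refine Finset.sum_le_sum fun i _ => ?_
  rw [standardizedWeight, abs_mul, abs_of_nonneg (Real.sqrt_nonneg _)]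
  nlinarith [sqrt_V_diag_le (β := β) ht i, abs_nonneg (x i)]

/-- Each endpoint contributes at most 3 from its own coefficient and 2 from the common shift, so 10
in total. The assumption `1 ≤ vTotal β` serves only to replace `√(vTotal β)` by `vTotal β`. -/
lemma abs_degreeWeight_add_le (ht : 2 ≤ t) (hT : 1 ≤ vTotal β) (x : Fin t → ℝ) (i j : Fin t) :
    |degreeWeight β (standardizedWeight β x) i + degreeWeight β (standardizedWeight β x) j|
      ≤ 10 * (∑ i, |x i|) * (Real.exp (L β) / √t) := by
  have h1 : ∀ k, |standardizedWeight β x k / V β k k|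
      ≤ 3 * (∑ i, |x i|) * (Real.exp (L β) / √t) := fun k =>
    (Finset.single_le_sum (f := fun k => |standardizedWeight β x k / V β k k|)
      (fun _ _ => abs_nonneg _) (Finset.mem_univ k)).trans
      (sum_abs_standardizedWeight_div_le ht x)
  have h2 : |(∑ i, standardizedWeight β x i) / vTotal β|
      ≤ 2 * (∑ i, |x i|) * (Real.exp (L β) / √t) := by
    have hT0 : 0 < vTotal β := by linarith
    rw [abs_div, abs_of_pos hT0, div_le_iff₀ hT0]
    refine (abs_sum_standardizedWeight_le ht x).trans ?_
    have : √(vTotal β) ≤ vTotal β := Real.sqrt_le_self_iff.2 (Or.inr hT)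
    gcongr
  have h3 : ∀ k, |degreeWeight β (standardizedWeight β x) k|
      ≤ 5 * (∑ i, |x i|) * (Real.exp (L β) / √t) := fun k =>
    (abs_sub _ _).trans (by linarith [h1 k])
  exact (abs_add_le _ _).trans (by linarith [h3 i, h3 j])

/-- The standardization makes the main term exactly `∑ x i ^ 2`; the constant is 3 for the shared
edges plus 8 for the correction. -/
lemma abs_variance_sub_le (ht : 2 ≤ t) (x : Fin t → ℝ) :
    |∑ e : {e : Fin t × Fin t // e.1 < e.2},
        (degreeWeight β (standardizedWeight β x) e.1.1
          + degreeWeight β (standardizedWeight β x) e.1.2) ^ 2 * V β e.1.1 e.1.2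
        - ∑ i, x i ^ 2|
      ≤ 11 * ((∑ i, |x i|) * (Real.exp (L β) / √t)) ^ 2 := by
  have hV := fun i => V_diag_pos (β := β) ht i
  have hT := vTotal_pos (β := β) ht
  rw [sum_sq_degreeWeight_add_mul_V _ (fun i => (hV i).ne') hT.ne']
  have h1 : ∑ i, standardizedWeight β x i ^ 2 / V β i i = ∑ i, x i ^ 2 := by
    refine Finset.sum_congr rfl fun i _ => ?_
    rw [standardizedWeight, mul_pow, Real.sq_sqrt (hV i).le, mul_div_cancel_right₀ _ (hV i).ne']
  have h2 : |∑ i, ∑ j ∈ Finset.univ.erase i, standardizedWeight β x i / V β i i *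
        (standardizedWeight β x j / V β j j) * V β i j|
      ≤ 3 * ((∑ i, |x i|) * (Real.exp (L β) / √t)) ^ 2 := by
    set w : Fin t → ℝ := fun i => standardizedWeight β x i / V β i i
    have hw := sum_abs_standardizedWeight_div_le (β := β) ht x
    have hw0 : 0 ≤ ∑ i, |w i| := Finset.sum_nonneg fun _ _ => abs_nonneg _
    calc |∑ i, ∑ j ∈ Finset.univ.erase i, w i * w j * V β i j|
        ≤ ∑ i, ∑ j ∈ Finset.univ.erase i, |w i| * |w j| * (1 / 4) := by
          refine (Finset.abs_sum_le_sum_abs _ _).trans (Finset.sum_le_sum fun i _ => ?_)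
          refine (Finset.abs_sum_le_sum_abs _ _).trans (Finset.sum_le_sum fun j hj => ?_)
          have hij := (Finset.ne_of_mem_erase hj).symm
          rw [abs_mul, abs_mul, abs_of_nonneg (V_nonneg hij)]
          exact mul_le_mul_of_nonneg_left (V_le hij) (by positivity)
      _ ≤ ∑ i, ∑ j, |w i| * |w j| * (1 / 4) :=
          Finset.sum_le_sum fun i _ => Finset.sum_le_sum_of_subset_of_nonneg
            (Finset.subset_univ _) fun _ _ _ => by positivity
      _ = (∑ i, |w i|) ^ 2 * (1 / 4) := by
          rw [sq, Finset.sum_mul_sum, Finset.sum_mul]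
          simp_rw [Finset.sum_mul]
      _ ≤ (3 * (∑ i, |x i|) * (Real.exp (L β) / √t)) ^ 2 * (1 / 4) := by gcongr
      _ ≤ _ := by nlinarith [sq_nonneg ((∑ i, |x i|) * (Real.exp (L β) / √t))]
  have h3 : 2 * (∑ i, standardizedWeight β x i) ^ 2 / vTotal β
      ≤ 8 * ((∑ i, |x i|) * (Real.exp (L β) / √t)) ^ 2 := by
    rw [div_le_iff₀ hT]
    have h := pow_le_pow_left₀ (abs_nonneg _) (abs_sum_standardizedWeight_le (β := β) ht x) 2
    rw [sq_abs, mul_pow _ (√(vTotal β)), Real.sq_sqrt hT.le] at h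
    linarith
  have h4 : 0 ≤ 2 * (∑ i, standardizedWeight β x i) ^ 2 / vTotal β := by positivity
  rw [h1, abs_le]
  rw [abs_le] at h2
  constructor <;> linarith [h2.1, h2.2]

/-- A quantitative central limit theorem for linear combinations of the entries of
`S (d - E d)`. -/
lemma IsBetaModel.norm_charFun_sub_le {Ω : Type*} [MeasurableSpace Ω] {P : Measure Ω}
    [IsProbabilityMeasure P] {G : Ω → SimpleGraph (Fin t)} (hG : IsBetaModel P β G)
    (ht : 2 ≤ t) (hT : 1 ≤ vTotal β) (x : Fin t → ℝ)
    (hx : 10 * (∑ i, |x i|) * (Real.exp (L β) / √t) ≤ 1) :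
    ∃ σ : ℝ, |σ - ∑ i, x i ^ 2| ≤ 11 * ((∑ i, |x i|) * (Real.exp (L β) / √t)) ^ 2 ∧
      ‖charFun (P.map fun ω =>
          ∑ i, standardizedWeight β x i * (S β).mulVec (centredDegree P G ω) i) 1
          - Complex.exp ((-(σ / 2) : ℝ) : ℂ)‖
        ≤ 2 * (10 * (∑ i, |x i|) * (Real.exp (L β) / √t)) * σ := by
  refine ⟨_, abs_variance_sub_le ht x, ?_⟩
  simp_rw [hG.sum_mul_S_mulVec_centredDegree]
  have h := norm_charFun_sum_bernoulli_sub_le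
    (fun e : {e : Fin t × Fin t // e.1 < e.2} => hG.measurableSet_adj e.1.1 e.1.2) hG.indep_adj
    (fun e => hG.measureReal_adj e.2.ne)
    (c := fun e => degreeWeight β (standardizedWeight β x) e.1.1
      + degreeWeight β (standardizedWeight β x) e.1.2)
    (fun e => abs_degreeWeight_add_le ht hT x e.1.1 e.1.2) hx
  have hv : ∀ e : {e : Fin t × Fin t // e.1 < e.2},
      edgeProb β e.1.1 e.1.2 * (1 - edgeProb β e.1.1 e.1.2) = V β e.1.1 e.1.2 :=
    fun e => edgeProb_mul_one_sub e.2.ne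
  simp_rw [hv] at h
  exact h

end Bounds

/-! ### Standardization and reduction to scalar variables. -/

/-- The diagonal matrix of the square roots of the diagonal of the leading block of `G_t⁻¹`. -/
noncomputable def rootBlock (r : ℕ) {t : ℕ} (β : Fin t → ℝ) : Matrix (Fin r) (Fin r) ℝ :=
  Matrix.diagonal fun i => √(leadingBlock r (Ginv β) i i)

lemma leadingBlock_Ginv {r t : ℕ} (h : r ≤ t) (β : Fin t → ℝ) :
    leadingBlock r (Ginv β)
      = Matrix.diagonal fun i => (V β (Fin.castLE h i) (Fin.castLE h i))⁻¹ := by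
  rw [leadingBlock, dif_pos h, Ginv, Matrix.submatrix_diagonal _ _ (Fin.castLE_injective h)]
  rfl

lemma rootBlock_eq {r t : ℕ} (h : r ≤ t) (β : Fin t → ℝ) :
    rootBlock r β = Matrix.diagonal fun i => √(V β (Fin.castLE h i) (Fin.castLE h i))⁻¹ := by
  simp [rootBlock, leadingBlock_Ginv h]

lemma posDef_rootBlock {r t : ℕ} (h : r ≤ t) (ht : 2 ≤ t) (β : Fin t → ℝ) :
    (rootBlock r β).PosDef := by
  rw [rootBlock_eq h]
  exact Matrix.PosDef.diagonal fun i => Real.sqrt_pos.2 (inv_pos.2 (V_diag_pos ht _))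

lemma rootBlock_mul_self {r t : ℕ} (h : r ≤ t) (ht : 2 ≤ t) (β : Fin t → ℝ) :
    rootBlock r β * rootBlock r β = leadingBlock r (Ginv β) := by
  rw [rootBlock_eq h, leadingBlock_Ginv h, Matrix.diagonal_mul_diagonal]
  congr 1
  funext i
  exact Real.mul_self_sqrt (inv_nonneg.2 (V_diag_pos ht _).le)

lemma inv_rootBlock {r t : ℕ} (h : r ≤ t) (ht : 2 ≤ t) (β : Fin t → ℝ) :
    (rootBlock r β)⁻¹
      = Matrix.diagonal fun i => √(V β (Fin.castLE h i) (Fin.castLE h i)) := by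
  refine Matrix.inv_eq_right_inv ?_
  rw [rootBlock_eq h, Matrix.diagonal_mul_diagonal, ← Matrix.diagonal_one]
  congr 1
  funext i
  rw [Real.sqrt_inv, inv_mul_cancel₀ (Real.sqrt_pos.2 (V_diag_pos ht _)).ne']

/-- The extension by zero of a vector of length `r` to a vector of length `t`. -/
def extendZero {r : ℕ} (t : ℕ) (u : Fin r → ℝ) (k : Fin t) : ℝ :=
  if h : (k : ℕ) < r then u ⟨k, h⟩ else 0

lemma sum_extendZero {r t : ℕ} (h : r ≤ t) (u : Fin r → ℝ) (f : Fin t → ℝ → ℝ)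
    (hf : ∀ k, f k 0 = 0) :
    ∑ k, f k (extendZero t u k) = ∑ i, f (Fin.castLE h i) (u i) := by
  symm
  refine Fintype.sum_of_injective _ (Fin.castLE_injective h) _ _ ?_ ?_
  · intro k hk
    have : ¬ (k : ℕ) < r := fun hlt => hk ⟨⟨k, hlt⟩, rfl⟩
    simp [extendZero, this, hf]
  · intro i
    simp [extendZero]

lemma measurable_firstElems (r : ℕ) {t : ℕ} : Measurable (firstElems r (t := t)) := by
  by_cases h : r ≤ t
  · have : firstElems r (t := t) = fun x i => x (Fin.castLE h i) := by
      funext x; simp [firstElems, h]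
    rw [this]
    fun_prop
  · have : firstElems r (t := t) = fun _ => 0 := by
      funext x; simp [firstElems, h]
    rw [this]
    fun_prop

lemma measurable_matrix_mulVec {m n : ℕ} (A : Matrix (Fin m) (Fin n) ℝ) :
    Measurable fun x : Fin n → ℝ => A.mulVec x :=
  (Continuous.matrix_mulVec continuous_const continuous_id).measurable

lemma inner_inv_rootBlock {r t : ℕ} (h : r ≤ t) (ht : 2 ≤ t) (β : Fin t → ℝ)
    (y : Fin t → ℝ) (u : EuclideanSpace ℝ (Fin r)) :
    inner ℝ (WithLp.toLp 2 ((rootBlock r β)⁻¹.mulVec (firstElems r y - 0))) u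
      = ∑ k, standardizedWeight β (extendZero t u) k * y k := by
  have e := sum_extendZero h u (fun k z => z * √(V β k k) * y k) (by simp)
  simp only [standardizedWeight]
  rw [e, inv_rootBlock h ht, PiLp.inner_apply]
  refine Finset.sum_congr rfl fun i _ => ?_
  simp [Matrix.mulVec_diagonal, firstElems, h]
  ring

/-- The Cramér–Wold reduction: scalar estimates at frequency 1 suffice, since the direction `u` is
absorbed into the coefficients. -/
lemma charFun_map_eq_charFun_map_inner {Ω E : Type*} [MeasurableSpace Ω] {P : Measure Ω}
    [NormedAddCommGroup E] [InnerProductSpace ℝ E] [MeasurableSpace E] [BorelSpace E]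
    [SecondCountableTopology E] {Y : Ω → E} (hY : Measurable Y) (u : E) :
    charFun (P.map Y) u = charFun (P.map fun ω => inner ℝ (Y ω) u) 1 := by
  rw [charFun_apply, charFun_apply_real, integral_map hY.aemeasurable (by fun_prop),
    integral_map (by fun_prop) (by fun_prop)]
  simp

end BetaModel

/-! ### Passage to the limit. -/

theorem proposition2
    (β : ∀ t : ℕ, Fin t → ℝ)
    {Ω : ℕ → Type*} [∀ t, MeasurableSpace (Ω t)]
    (P : ∀ t, Measure (Ω t)) [∀ t, IsProbabilityMeasure (P t)]
    (G : ∀ t, Ω t → SimpleGraph (Fin t))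
    (hG : ∀ t, BetaModel.IsBetaModel (P t) (β t) (G t))
    (hL : (fun t : ℕ => Real.exp (BetaModel.L (β t))) =o[atTop]
      fun t : ℕ => (t : ℝ) ^ (1 / 2 : ℝ))
    (r : ℕ) (hr : 1 ≤ r) :
    BetaModel.IsAsymptoticallyNormal P
      (fun t ω => BetaModel.firstElems r
        ((BetaModel.S (β t)).mulVec (BetaModel.centredDegree (P t) (G t) ω)))
      (fun _ => 0)
      (fun t => BetaModel.leadingBlock r (BetaModel.Ginv (β t))) := by
  open BetaModel Topology in
  refine ⟨fun t => rootBlock r (β t), ?_, ?_⟩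
  · filter_upwards [eventually_ge_atTop r, eventually_ge_atTop 2] with t h ht
    exact ⟨posDef_rootBlock h ht _, rootBlock_mul_self h ht _⟩
  have hmeas : ∀ t, Measurable fun ω => WithLp.toLp 2 ((rootBlock r (β t))⁻¹.mulVec
      (firstElems r ((S (β t)).mulVec (centredDegree (P t) (G t) ω)) - 0)) := fun t =>
    (WithLp.measurable_toLp 2 _).comp ((measurable_matrix_mulVec _).comp
      (((measurable_firstElems r).comp ((measurable_matrix_mulVec _).comp
        (hG t).measurable_centredDegree)).sub_const 0))
  refine ⟨fun t => (hmeas t).aemeasurable, by fun_prop, ?_⟩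
  refine ProbabilityMeasure.tendsto_iff_tendsto_charFun.2 fun u => ?_
  simp only [ProbabilityMeasure.coe_mk, Measure.map_id', charFun_stdGaussian]
  set q : ℕ → ℝ := fun t => Real.exp (L (β t)) / √t
  have hq : Tendsto q atTop (𝓝 0) := by
    simpa only [← Real.sqrt_eq_rpow] using hL.tendsto_div_nhds_zero
  have hT : ∀ᶠ t in atTop, 1 ≤ vTotal (β t) := by
    have h8 : Tendsto (fun t => 8 * q t ^ 2) atTop (𝓝 0) := by
      simpa using (hq.pow 2).const_mul 8
    filter_upwards [h8.eventually_le_const one_pos, eventually_ge_atTop 2] with t h1 ht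
    have h2 := le_mul_vTotal (β := β t) ht
    have ht' : (2 : ℝ) ≤ t := by exact_mod_cast ht
    have h3 := mul_le_mul_of_nonneg_right h1 (vTotal_pos (β := β t) ht).le
    simp only [q] at h3
    linarith
  set U : ℝ := ∑ i, |u i|
  have hM : Tendsto (fun t => 10 * U * q t) atTop (𝓝 0) := by
    simpa using hq.const_mul (10 * U)
  have key : ∀ᶠ t in atTop, ∃ σ : ℝ, |σ - ‖u‖ ^ 2| ≤ 11 * (U * q t) ^ 2 ∧
      ‖charFun ((P t).map fun ω => WithLp.toLp 2 ((rootBlock r (β t))⁻¹.mulVec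
          (firstElems r ((S (β t)).mulVec (centredDegree (P t) (G t) ω)) - 0))) u
        - Complex.exp ((-(σ / 2) : ℝ) : ℂ)‖ ≤ 2 * (10 * U * q t) * σ := by
    filter_upwards [hT, eventually_ge_atTop r, eventually_ge_atTop 2,
      hM.eventually_le_const one_pos] with t hT h ht hM
    have e1 : ∑ k, |extendZero t u k| = U := sum_extendZero h u (fun _ z => |z|) (by simp)
    have e2 : ∑ k, extendZero t u k ^ 2 = ‖u‖ ^ 2 := by
      rw [sum_extendZero h u (fun _ z => z ^ 2) (by simp), EuclideanSpace.real_norm_sq_eq]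
    have := (hG t).norm_charFun_sub_le ht hT (extendZero t u) (by rw [e1]; exact hM)
    rw [e1, e2] at this
    rw [charFun_map_eq_charFun_map_inner (hmeas t)]
    simp_rw [inner_inv_rootBlock h ht]
    exact this
  -- The variances exist only for large `t`; this chooses them as one sequence, so that their limit
  -- makes sense.
  obtain ⟨σ, hσ⟩ := key.choice
  have hσlim : Tendsto σ atTop (𝓝 (‖u‖ ^ 2)) := by
    rw [tendsto_iff_norm_sub_tendsto_zero]
    refine squeeze_zero' (.of_forall fun _ => norm_nonneg _) (hσ.mono fun t h => h.1) ?_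
    simpa using ((hq.const_mul U).pow 2).const_mul 11
  have hexp : Tendsto (fun t => Complex.exp ((-(σ t / 2) : ℝ) : ℂ)) atTop
      (𝓝 (Complex.exp (-(‖u‖ : ℂ) ^ 2 / 2))) := by
    have : -(‖u‖ : ℂ) ^ 2 / 2 = ((-(‖u‖ ^ 2 / 2) : ℝ) : ℂ) := by push_cast; ring
    rw [this]
    exact (Complex.continuous_exp.comp Complex.continuous_ofReal).continuousAt.tendsto.comp
      (hσlim.div_const 2).neg
  have hdiff := squeeze_zero_norm' (hσ.mono fun t h => h.2)
    (by simpa using (hM.const_mul 2).mul hσlim)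
  simpa using hdiff.add hexp
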